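/- Let $\Lambda=\mathbb{C}[p_1,p_2,p_3,\ldots]$ be the ring of symmetric functions, where $p_k$ is the $k$-th power sum, and let the Bernstein operators $B_n$ ($n\in\mathbb{Z}$) on $\Lambda$ be defined by $$\sum_{n\in\mathbb{Z}}B_nt^n=\exp\left(\sum_{k\geq 1}\frac{t^k}{k}p_k\right)\exp\left(-\sum_{k\geq 1}t^{-k}\frac{\partial}{\partial p_k}\right),$$ where $p_k$ acts by multiplication. For a finite sequence $\mu=(\mu_1,\ldots,\mu_l)$ of nonnegative integers put $B_\mu=B_{\mu_1}B_{\mu_2}\cdots B_{\mu_l}$. Let $\mu=(\mu_1,\ldots,\mu_l)$ be any composition of $m$, that is, a sequence of nonnegative integers with sum $m$. Then either $B_\mu=0$, or $B_\mu=B_\lambda$ or $B_\mu=-B_\lambda$ for some partition $\lambda=(\lambda_1\geq\lambda_2\geq\cdots\geq\lambda_l\geq 0)$ of $m$ with the same length $l$ as $\mu$. Moreover, if all parts of $\mu$ are positive, $\lambda$ can be chosen with all parts positive. -/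

import Mathlib

/-- The ring of symmetric functions `Λ = ℂ[p₁, p₂, p₃, …]`, as the polynomial ring in the power
sums: the variable `X k` is the power sum `p_k`, for `k ≥ 1`. -/
abbrev SymFun : Type := MvPolynomial ℕ+ ℂ

/-- The ring of `ℂ`-linear operators on `Λ`; the product is composition. -/
abbrev SymOp : Type := Module.End ℂ SymFun

namespace Bernstein

/-- The exponential `∑_{r ≥ 0} F ^ r / r!` of a formal power series `F` without constant term, over
a possibly noncommutative `ℂ`-algebra. The coefficient of `t ^ n` of `F ^ r` vanishes for `r > n`,
so that the sum over `r` may stop at `r = n`. -/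
noncomputable def formalExp {A : Type*} [Ring A] [Algebra ℂ A] (F : PowerSeries A) :
    PowerSeries A :=
  PowerSeries.mk fun n =>
    ∑ r ∈ Finset.range (n + 1), ((r.factorial : ℂ)⁻¹) • PowerSeries.coeff n (F ^ r)

/-- Multiplication by the power sum `p_k`, as an operator on `Λ`. -/
noncomputable def mulP (k : ℕ+) : SymOp :=
  LinearMap.mulLeft ℂ (MvPolynomial.X k : SymFun)

/-- The partial derivative `∂/∂p_k`, as an operator on `Λ`. -/
noncomputable def derivP (k : ℕ+) : SymOp :=
  (MvPolynomial.pderiv (R := ℂ) k).toLinearMap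

/-- The series `∑_{k ≥ 1} (t ^ k / k) p_k`, where `p_k` acts on `Λ` by multiplication. -/
noncomputable def creationSeries : PowerSeries SymOp :=
  PowerSeries.mk fun k =>
    if h : 0 < k then ((k : ℂ)⁻¹) • mulP (k.toPNat h) else 0

/-- The series `-∑_{k ≥ 1} u ^ k ∂/∂p_k`, where the formal variable `u` stands for `t⁻¹`. -/
noncomputable def annihilationSeries : PowerSeries SymOp :=
  PowerSeries.mk fun k =>
    if h : 0 < k then -derivP (k.toPNat h) else 0

/-- The coefficient of `t ^ i`, `i ∈ ℤ`, of `exp (∑_{k ≥ 1} (t ^ k / k) p_k)`; it is `0` for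
negative `i`. -/
noncomputable def creation (i : ℤ) : SymOp :=
  if 0 ≤ i then PowerSeries.coeff i.toNat (formalExp creationSeries) else 0

/-- The coefficient of `t ^ (-j)`, `j ∈ ℕ`, of `exp (-∑_{k ≥ 1} t ^ (-k) ∂/∂p_k)`. -/
noncomputable def annihilation (j : ℕ) : SymOp :=
  PowerSeries.coeff j (formalExp annihilationSeries)

/-- Polynomials all of whose monomials have weight at most `d`, where `p_k` has weight `k`. -/
def weightLE (d : ℤ) : Submodule ℂ SymFun where
  carrier := {f | ∀ s, MvPolynomial.coeff s f ≠ 0 →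
    (Finsupp.weight (fun k : ℕ+ => (k : ℕ)) s : ℤ) ≤ d}
  zero_mem' := by intro s hs; simp at hs
  add_mem' := by
    intro f g hf hg s hs
    by_cases h : MvPolynomial.coeff s f = 0
    · apply hg s
      intro h'
      apply hs
      simp [h, h']
    · exact hf s h
  smul_mem' := by
    intro c f hf s hs
    apply hf s
    intro h
    apply hs
    simp [h]

/-- Differentiation by `p_k` lowers the weight by `k`. -/
theorem derivP_mem (k : ℕ+) (d : ℤ) (f : SymFun) (hf : f ∈ weightLE d) :
    derivP k f ∈ weightLE (d - (k : ℕ)) := by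
  change MvPolynomial.pderiv k f ∈ _
  intro s hs
  have h : MvPolynomial.coeff (s + Finsupp.single k 1) f ≠ 0 := by
    intro h
    apply hs
    rw [MvPolynomial.coeff_pderiv, h]
    simp
  have := hf _ h
  simp only [map_add, Finsupp.weight_single, one_smul, Nat.cast_add] at this
  linarith

theorem annihilationSeries_pow_mem (r : ℕ) : ∀ (n : ℕ) (d : ℤ) (f : SymFun), f ∈ weightLE d →
    PowerSeries.coeff n (annihilationSeries ^ r) f ∈ weightLE (d - n) := by
  induction r with
  | zero =>
    intro n d f hf
    rw [pow_zero, PowerSeries.coeff_one]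
    split_ifs with h
    · simpa [h] using hf
    · exact Submodule.zero_mem _
  | succ r ih =>
    intro n d f hf
    rw [pow_succ, PowerSeries.coeff_mul, LinearMap.sum_apply]
    refine Submodule.sum_mem _ fun ij hij => ?_
    rw [Finset.HasAntidiagonal.mem_antidiagonal] at hij
    have h1 : PowerSeries.coeff ij.2 annihilationSeries f ∈ weightLE (d - ij.2) := by
      rw [annihilationSeries, PowerSeries.coeff_mk]
      by_cases h : 0 < ij.2
      · rw [dif_pos h]
        exact Submodule.neg_mem _ (derivP_mem (ij.2.toPNat h) d f hf)
      · rw [dif_neg h]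
        exact Submodule.zero_mem _
    have h2 := ih ij.1 _ _ h1
    have h3 : d - (ij.2 : ℤ) - (ij.1 : ℤ) = d - n := by
      rw [← hij]; push_cast; ring
    rw [h3] at h2
    exact h2

theorem annihilation_mem (n : ℕ) (d : ℤ) (f : SymFun) (hf : f ∈ weightLE d) :
    annihilation n f ∈ weightLE (d - n) := by
  rw [annihilation, formalExp, PowerSeries.coeff_mk, LinearMap.sum_apply]
  exact Submodule.sum_mem _ fun r _ =>
    Submodule.smul_mem _ _ (annihilationSeries_pow_mem r n d f hf)

/-- Only finitely many coefficients of `exp (-∑_{k ≥ 1} t ^ (-k) ∂/∂p_k)` act on a given `f` in a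
non-zero way. -/
theorem annihilation_finite (f : SymFun) : (Function.support fun j => annihilation j f).Finite := by
  obtain ⟨d, hd⟩ : ∃ d : ℕ, f ∈ weightLE d := by
    refine ⟨f.support.sup (Finsupp.weight (fun k : ℕ+ => (k : ℕ))), fun s hs => ?_⟩
    exact_mod_cast Finset.le_sup (f := Finsupp.weight (fun k : ℕ+ => (k : ℕ)))
      (MvPolynomial.mem_support_iff.mpr hs)
  refine (Set.finite_Iic d).subset fun j hj => ?_
  by_contra hlt
  apply hj
  ext s
  by_contra hs
  have h1 := annihilation_mem j d f hd s hs
  simp only [Set.mem_Iic, not_le] at hlt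
  omega

theorem creation_annihilation_finite (n : ℤ) (f : SymFun) :
    (Function.support fun j : ℕ => creation (n + j) (annihilation j f)).Finite := by
  refine (annihilation_finite f).subset fun j hj h => hj ?_
  simp only at h
  simp only [h, map_zero]

/-- The Bernstein operator `B_n`, `n ∈ ℤ`: the coefficient of `t ^ n` in
`B(t) = exp (∑_{k ≥ 1} (t ^ k / k) p_k) exp (-∑_{k ≥ 1} t ^ (-k) ∂/∂p_k)`, that is, the sum over
all `j ≥ 0` of (coefficient of `t ^ (n + j)` of the first factor) ∘ (coefficient of `t ^ (-j)` of
the second factor). On each `f` only finitely many of the summands are non-zero. -/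
noncomputable def B (n : ℤ) : SymOp where
  toFun f := ∑ᶠ j : ℕ, creation (n + j) (annihilation j f)
  map_add' f g := by
    simp only [map_add]
    exact finsum_add_distrib (creation_annihilation_finite n f) (creation_annihilation_finite n g)
  map_smul' c f := by
    simp only [map_smul, RingHom.id_apply]
    exact (smul_finsum c _).symm

/-- `B_μ = B_{μ₁} B_{μ₂} ⋯ B_{μ_l}` for `μ = (μ₁, …, μ_l)`. -/
noncomputable def BSeq (μ : List ℕ) : SymOp :=
  (μ.map fun i => B (i : ℤ)).prod

/-- `μ = (μ₁, …, μ_l)` is a composition of `m`: a finite sequence of nonnegative integers with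
sum `m`. Its length is `l`. -/
def IsCompositionOf (μ : List ℕ) (m : ℕ) : Prop :=
  μ.sum = m

/-- `ν = (ν₁, …, ν_l)` is a partition of `m`: a sequence of nonnegative integers
`ν₁ ≥ ν₂ ≥ … ≥ ν_l` with sum `m`. Its length is `l`. -/
def IsPartitionOf (ν : List ℕ) (m : ℕ) : Prop :=
  ν.Pairwise (fun a b => b ≤ a) ∧ ν.sum = m

end Bernstein

/-! The core is the straightening rule `B_mul_B`: B_a B_b = -B_{b-1} B_{a+1}. With b = a + 1 it
forces B_a B_{a+1} = 0. At an ascent a < b of μ, either the product vanishes or the pair becomes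
(b-1, a+1), at the cost of a sign; sum and length are kept and the sum of squares drops, so the
process ends at zero or at a partition. For the rule, let H(t) and A(s) be the two exponential
factors. Since [∂/∂p_k, p_k] = 1, moving A(s) past H(u) produces the scalar exp(-∑ (su)^k / k) = 1 -
su. Hence B_a B_b = S(a, b) - S(a+1, b-1), where S is the normally ordered product. As the
coefficients of H commute, and likewise those of A, S is symmetric, and the rule follows. -/

namespace Bernstein

/-! ### Exponentials of power series with noncommuting coefficients -/

section FormalExp

variable {A : Type*} [Ring A]

/-- The Euler operator `t d/dt` on formal power series. -/
noncomputable def euler (F : PowerSeries A) : PowerSeries A :=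
  PowerSeries.mk fun n => (n : A) * PowerSeries.coeff n F

theorem euler_mul (F G : PowerSeries A) : euler (F * G) = euler F * G + F * euler G := by
  ext n
  simp only [euler, PowerSeries.coeff_mk, map_add, PowerSeries.coeff_mul, Finset.mul_sum,
    ← Finset.sum_add_distrib]
  refine Finset.sum_congr rfl fun p hp => ?_
  rw [Finset.HasAntidiagonal.mem_antidiagonal] at hp
  rw [← hp, Nat.cast_add, add_mul, ← mul_assoc, ← mul_assoc, ← mul_assoc,
    (Nat.cast_commute p.2 (PowerSeries.coeff p.1 F)).eq]

/-- Commuting coefficients make `F` commute with `euler F`, so the power rule holds as over a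
commutative ring. -/
theorem euler_pow (F : PowerSeries A)
    (hF : ∀ i j, Commute (PowerSeries.coeff i F) (PowerSeries.coeff j F)) (r : ℕ) :
    euler (F ^ (r + 1)) = ((r + 1 : ℕ) : PowerSeries A) * (euler F * F ^ r) := by
  have hc : Commute F (euler F) := by
    ext n
    rw [PowerSeries.coeff_mul, PowerSeries.coeff_mul, ← Finset.Nat.sum_antidiagonal_swap]
    refine Finset.sum_congr rfl fun p _ => ?_
    simp only [euler, PowerSeries.coeff_mk, Prod.fst_swap, Prod.snd_swap]
    exact ((Nat.cast_commute _ _).symm.mul_right (hF _ _)).eq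
  induction r with
  | zero => simp
  | succ r ih =>
    rw [pow_succ', euler_mul, ih, ← mul_assoc F, (Nat.cast_commute (r + 1) F).symm.eq,
      mul_assoc _ F, ← mul_assoc F, hc.eq, mul_assoc (euler F), ← pow_succ']
    push_cast
    noncomm_ring

theorem coeff_pow_eq_zero (F : PowerSeries A) (h0 : PowerSeries.coeff 0 F = 0) (r : ℕ) :
    ∀ n, n < r → PowerSeries.coeff n (F ^ r) = 0 := by
  induction r with
  | zero => intro n hn; omega
  | succ r ih =>
    intro n hn
    rw [pow_succ, PowerSeries.coeff_mul]
    refine Finset.sum_eq_zero fun p hp => ?_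
    rw [Finset.HasAntidiagonal.mem_antidiagonal] at hp
    rcases Nat.eq_zero_or_pos p.2 with h | h
    · rw [h, h0, mul_zero]
    · rw [ih p.1 (by omega), zero_mul]

variable [Algebra ℂ A]

/-- Allows coefficients of different degrees to share one range of summation. -/
theorem coeff_formalExp (F : PowerSeries A) (h0 : PowerSeries.coeff 0 F = 0) {n N : ℕ}
    (h : n < N) : PowerSeries.coeff n (formalExp F) =
      ∑ r ∈ Finset.range N, ((r.factorial : ℂ)⁻¹) • PowerSeries.coeff n (F ^ r) := by
  rw [formalExp, PowerSeries.coeff_mk]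
  refine Finset.sum_subset (fun r hr => ?_) fun r _ hr => ?_
  · rw [Finset.mem_range] at hr ⊢
    omega
  · rw [Finset.mem_range] at hr
    rw [coeff_pow_eq_zero F h0 r n (by omega), smul_zero]

theorem euler_formalExp (F : PowerSeries A) (h0 : PowerSeries.coeff 0 F = 0)
    (hF : ∀ i j, Commute (PowerSeries.coeff i F) (PowerSeries.coeff j F)) :
    euler (formalExp F) = euler F * formalExp F := by
  ext n
  have h1 : PowerSeries.coeff n (euler F * formalExp F) = ∑ r ∈ Finset.range (n + 1),
      ((r.factorial : ℂ)⁻¹) • PowerSeries.coeff n (euler F * F ^ r) := by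
    simp only [PowerSeries.coeff_mul, Finset.smul_sum]
    rw [Finset.sum_comm]
    refine Finset.sum_congr rfl fun p hp => ?_
    rw [Finset.HasAntidiagonal.mem_antidiagonal] at hp
    rw [coeff_formalExp F h0 (show p.2 < n + 1 by omega), Finset.mul_sum]
    exact Finset.sum_congr rfl fun r _ => mul_smul_comm _ _ _
  -- One extra term is taken on the left: the `r = 0` term is killed by the Euler operator, and the
  -- others match the right side after a shift of `r`.
  rw [h1, euler, PowerSeries.coeff_mk, coeff_formalExp F h0 (show n < n + 1 + 1 by omega),
    Finset.sum_range_succ', mul_add, Finset.mul_sum]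
  have h2 : (n : A) * ((((0 : ℕ).factorial : ℂ)⁻¹) • PowerSeries.coeff n (F ^ 0)) = 0 := by
    rw [pow_zero, PowerSeries.coeff_one]
    split_ifs with h
    · simp [h]
    · simp
  rw [h2, add_zero]
  refine Finset.sum_congr rfl fun r _ => ?_
  have h3 := congrArg (PowerSeries.coeff n) (euler_pow F hF r)
  rw [euler, PowerSeries.coeff_mk, ← nsmul_eq_mul ((r + 1 : ℕ)), map_nsmul] at h3
  rw [mul_smul_comm, h3, ← Nat.cast_smul_eq_nsmul ℂ, smul_smul]
  congr 1
  rw [Nat.factorial_succ]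
  have : ((r + 1 : ℕ) : ℂ) ≠ 0 := Nat.cast_ne_zero.mpr (Nat.succ_ne_zero r)
  have : (r.factorial : ℂ) ≠ 0 := Nat.cast_ne_zero.mpr r.factorial_ne_zero
  push_cast at *
  field_simp

/-- The coefficient of `t ^ n`, `n ∈ ℤ`, of `exp F`. -/
noncomputable def expCoeff (F : PowerSeries A) (n : ℤ) : A :=
  if 0 ≤ n then PowerSeries.coeff n.toNat (formalExp F) else 0

theorem expCoeff_of_neg (F : PowerSeries A) {n : ℤ} (h : n < 0) : expCoeff F n = 0 :=
  if_neg (by omega)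

theorem expCoeff_natCast (F : PowerSeries A) (n : ℕ) :
    expCoeff F n = PowerSeries.coeff n (formalExp F) := by
  simp [expCoeff]

theorem expCoeff_zero (F : PowerSeries A) : expCoeff F 0 = 1 := by
  simp [expCoeff, formalExp]

/-- The recursion `n E_n = ∑ k F_k E_{n - k}` for the coefficients of `E = exp F`. -/
theorem smul_expCoeff (F : PowerSeries A) (h0 : PowerSeries.coeff 0 F = 0)
    (hF : ∀ i j, Commute (PowerSeries.coeff i F) (PowerSeries.coeff j F)) {n : ℤ} {N : ℕ}
    (h : n ≤ N) : (n : ℂ) • expCoeff F n = ∑ k ∈ Finset.range N,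
      ((k : ℂ) + 1) • (PowerSeries.coeff (k + 1) F * expCoeff F (n - (k + 1))) := by
  rcases lt_or_ge n 0 with hn | hn
  · rw [expCoeff_of_neg F hn, smul_zero, Finset.sum_eq_zero]
    intro k _
    rw [expCoeff_of_neg F (by omega), mul_zero, smul_zero]
  lift n to ℕ using hn
  have hsub : Finset.range n ⊆ Finset.range N := Finset.range_mono (by exact_mod_cast h)
  rw [← Finset.sum_subset hsub]
  swap
  · intro k _ hk
    rw [Finset.mem_range] at hk
    rw [expCoeff_of_neg F (by omega), mul_zero, smul_zero]
  have h1 := congrArg (PowerSeries.coeff n) (euler_formalExp F h0 hF)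
  rw [PowerSeries.coeff_mul, Finset.Nat.sum_antidiagonal_eq_sum_range_succ_mk,
    Finset.sum_range_succ'] at h1
  simp only [euler, PowerSeries.coeff_mk, Nat.cast_zero, zero_mul, add_zero] at h1
  rw [expCoeff_natCast, Int.cast_natCast, Nat.cast_smul_eq_nsmul, nsmul_eq_mul, h1]
  refine Finset.sum_congr rfl fun k hk => ?_
  rw [Finset.mem_range] at hk
  have h2 : (n : ℤ) - (k + 1) = ((n - (k + 1) : ℕ) : ℤ) := by omega
  rw [h2, expCoeff_natCast, ← Nat.cast_succ, Nat.cast_smul_eq_nsmul, nsmul_eq_mul, mul_assoc]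

/-- If `x` commutes with all coefficients of `F` except that `[x, F_{k + 1}] = c`, then
`[x, E_n] = c E_{n - k - 1}` for the coefficients of `E = exp F`. -/
theorem mul_expCoeff (F : PowerSeries A) (h0 : PowerSeries.coeff 0 F = 0)
    (hF : ∀ i j, Commute (PowerSeries.coeff i F) (PowerSeries.coeff j F)) (x : A) (k : ℕ) (c : ℂ)
    (hx : ∀ l, x * PowerSeries.coeff (l + 1) F =
      PowerSeries.coeff (l + 1) F * x + if l = k then c • 1 else 0) (n : ℤ) :
    x * expCoeff F n = expCoeff F n * x + c • expCoeff F (n - (k + 1)) := by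
  obtain ⟨N, hN⟩ : ∃ N : ℕ, n ≤ N := ⟨n.toNat, Int.self_le_toNat n⟩
  induction N using Nat.strong_induction_on generalizing n with
  | _ N ih =>
  rcases lt_trichotomy n 0 with hn | hn | hn
  · rw [expCoeff_of_neg F hn, expCoeff_of_neg F (show n - (k + 1) < 0 by omega)]
    simp
  · subst hn
    rw [expCoeff_zero, expCoeff_of_neg F (show (0 : ℤ) - (k + 1) < 0 by omega)]
    simp
  have hn' : (n : ℂ) ≠ 0 := by exact_mod_cast hn.ne'
  refine smul_right_injective A hn' ?_
  simp only
  have hrec := smul_expCoeff F h0 hF hN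
  have hrec' := smul_expCoeff F h0 hF (show n - (k + 1) ≤ N by omega)
  rw [← mul_smul_comm, smul_add, ← smul_mul_assoc, hrec, Finset.mul_sum, Finset.sum_mul]
  -- Moving `x` past `F_{l+1}` and then, by induction, past the lower coefficient. The two
  -- correction terms sum to (n-k-1) c E_{n-k-1} and (k+1) c E_{n-k-1}, together n c E_{n-k-1}.
  have hterm : ∀ l ∈ Finset.range N,
      x * (((l : ℂ) + 1) • (PowerSeries.coeff (l + 1) F * expCoeff F (n - (l + 1)))) =
      (((l : ℂ) + 1) • (PowerSeries.coeff (l + 1) F * expCoeff F (n - (l + 1)))) * x +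
      (c • (((l : ℂ) + 1) •
        (PowerSeries.coeff (l + 1) F * expCoeff F (n - (k + 1) - (l + 1)))) +
      if l = k then (((k : ℂ) + 1) * c) • expCoeff F (n - (k + 1)) else 0) := by
    intro l hl
    rw [Finset.mem_range] at hl
    have hi := ih (N - 1) (by omega) (n - (l + 1)) (by omega)
    have hs : n - (k + 1) - (l + 1) = n - (l + 1) - (k + 1 : ℤ) := by ring
    rw [mul_smul_comm, ← mul_assoc, hx, add_mul, mul_assoc, hi, hs, mul_add, smul_add, smul_add,
      mul_smul_comm, smul_comm c, smul_mul_assoc, mul_assoc, add_assoc]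
    congr 2
    split_ifs with h
    · rw [h, smul_mul_assoc, one_mul, smul_smul]
    · simp
  rw [Finset.sum_congr rfl hterm, Finset.sum_add_distrib, Finset.sum_add_distrib,
    ← Finset.smul_sum, ← hrec', Finset.sum_ite_eq']
  congr 1
  split_ifs with h
  · rw [smul_smul, smul_smul, ← add_smul]
    congr 1
    push_cast
    ring
  -- Here n ≤ N ≤ k, so the index n - (k+1) is negative.
  · rw [Finset.mem_range] at h
    rw [expCoeff_of_neg F (show n - (k + 1) < 0 by omega)]
    simp

/-- `mul_expCoeff` with `c = 0`, used once for each factor. -/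
theorem commute_expCoeff (F : PowerSeries A) (h0 : PowerSeries.coeff 0 F = 0)
    (hF : ∀ i j, Commute (PowerSeries.coeff i F) (PowerSeries.coeff j F)) (m n : ℤ) :
    Commute (expCoeff F m) (expCoeff F n) := by
  have h1 : ∀ x : A, (∀ l, Commute x (PowerSeries.coeff l F)) → ∀ n, Commute x (expCoeff F n) :=
    fun x hx n => by
      have := mul_expCoeff F h0 hF x 0 0 (fun l => by simpa using (hx (l + 1)).eq) n
      rwa [zero_smul, add_zero] at this
  exact h1 _ (fun l => (h1 _ (hF l) m).symm) n

end FormalExp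

/-! ### Commutation relations of the creation and annihilation operators -/

section Operators

theorem coeff_zero_creationSeries : PowerSeries.coeff 0 creationSeries = 0 := by
  simp [creationSeries]

theorem coeff_zero_annihilationSeries : PowerSeries.coeff 0 annihilationSeries = 0 := by
  simp [annihilationSeries]

theorem coeff_succ_creationSeries (l : ℕ) :
    PowerSeries.coeff (l + 1) creationSeries = ((l : ℂ) + 1)⁻¹ • mulP l.succPNat := by
  rw [creationSeries, PowerSeries.coeff_mk, dif_pos l.succ_pos]
  push_cast
  rfl

theorem coeff_succ_annihilationSeries (l : ℕ) :
    PowerSeries.coeff (l + 1) annihilationSeries = -derivP l.succPNat := by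
  rw [annihilationSeries, PowerSeries.coeff_mk, dif_pos l.succ_pos]
  rfl

theorem SymOp.neg_mul (x y : SymOp) : -x * y = -(x * y) :=
  LinearMap.neg_comp y x

theorem SymOp.mul_neg (x y : SymOp) : x * -y = -(x * y) :=
  LinearMap.comp_neg y x

theorem commute_mulP (i j : ℕ+) : Commute (mulP i) (mulP j) :=
  LinearMap.ext fun f => by
    simp only [mulP, Module.End.mul_apply, LinearMap.mulLeft_apply]
    ring

theorem commute_derivP (i j : ℕ+) : Commute (derivP i) (derivP j) :=
  LinearMap.ext fun f => by
    -- The commutator is again a derivation, so it is enough to test it on the variables.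
    have h : ⁅MvPolynomial.pderiv (R := ℂ) i, MvPolynomial.pderiv (R := ℂ) j⁆ = 0 := by
      refine MvPolynomial.derivation_ext fun k => ?_
      simp only [Derivation.commutator_apply, MvPolynomial.pderiv_X, Derivation.coe_zero,
        Pi.zero_apply, Pi.single_apply]
      split_ifs <;> simp
    have := DFunLike.congr_fun h f
    rw [Derivation.commutator_apply, Derivation.coe_zero, Pi.zero_apply, sub_eq_zero] at this
    exact this

theorem derivP_mul_mulP (i j : ℕ+) :
    derivP i * mulP j = mulP j * derivP i + if j = i then 1 else 0 :=
  LinearMap.ext fun f => by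
    simp only [derivP, mulP, Module.End.mul_apply, LinearMap.mulLeft_apply, LinearMap.add_apply,
      Derivation.coeFn_coe, Derivation.leibniz, MvPolynomial.pderiv_X, Pi.single_apply,
      smul_eq_mul]
    split_ifs with h1
    · simp
    · simp

theorem commute_coeff_creationSeries (i j : ℕ) :
    Commute (PowerSeries.coeff i creationSeries) (PowerSeries.coeff j creationSeries) := by
  rcases i with _ | i
  · rw [coeff_zero_creationSeries]; exact Commute.zero_left _
  rcases j with _ | j
  · rw [coeff_zero_creationSeries]; exact Commute.zero_right _
  rw [coeff_succ_creationSeries, coeff_succ_creationSeries]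
  exact ((commute_mulP _ _).smul_left _).smul_right _

theorem commute_coeff_annihilationSeries (i j : ℕ) :
    Commute (PowerSeries.coeff i annihilationSeries) (PowerSeries.coeff j annihilationSeries) := by
  rcases i with _ | i
  · rw [coeff_zero_annihilationSeries]; exact Commute.zero_left _
  rcases j with _ | j
  · rw [coeff_zero_annihilationSeries]; exact Commute.zero_right _
  rw [coeff_succ_annihilationSeries, coeff_succ_annihilationSeries]
  exact (commute_derivP _ _).neg_left.neg_right

theorem commute_creation (i j : ℤ) : Commute (creation i) (creation j) :=
  commute_expCoeff _ coeff_zero_creationSeries commute_coeff_creationSeries i j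

theorem commute_annihilation (i j : ℕ) : Commute (annihilation i) (annihilation j) := by
  have := commute_expCoeff _ coeff_zero_annihilationSeries commute_coeff_annihilationSeries i j
  rwa [expCoeff_natCast, expCoeff_natCast] at this

theorem derivP_mul_creation (k : ℕ) (i : ℤ) : derivP k.succPNat * creation i =
    creation i * derivP k.succPNat + ((k : ℂ) + 1)⁻¹ • creation (i - (k + 1)) := by
  refine mul_expCoeff creationSeries coeff_zero_creationSeries commute_coeff_creationSeries
    (derivP k.succPNat) k _ (fun l => ?_) i
  rw [coeff_succ_creationSeries, mul_smul_comm, derivP_mul_mulP, smul_add, smul_mul_assoc]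
  congr 1
  by_cases h : l = k
  · simp [h]
  · rw [if_neg h, if_neg fun h' => h (Nat.succPNat_injective h'), smul_zero]

/-- The relation `A(s) H(u) = (1 - s u) H(u) A(s)`, in coefficients, between the two factors of
the Bernstein operators. -/
theorem expCoeff_annihilationSeries_mul_creation (j i : ℤ) :
    expCoeff annihilationSeries j * creation i = creation i * expCoeff annihilationSeries j -
      creation (i - 1) * expCoeff annihilationSeries (j - 1) := by
  obtain ⟨N, hN⟩ : ∃ N : ℕ, j ≤ N := ⟨j.toNat, Int.self_le_toNat j⟩
  induction N using Nat.strong_induction_on generalizing i j with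
  | _ N ih =>
  set a := expCoeff annihilationSeries with ha
  rcases lt_trichotomy j 0 with hj | hj | hj
  · rw [ha, expCoeff_of_neg _ hj, expCoeff_of_neg _ (show j - 1 < 0 by omega)]
    simp
  · subst hj
    rw [ha, expCoeff_zero, expCoeff_of_neg _ (show (0 : ℤ) - 1 < 0 by omega)]
    simp
  have hj' : (j : ℂ) ≠ 0 := by exact_mod_cast hj.ne'
  refine smul_right_injective _ hj' ?_
  simp only
  have hrec : ∀ j' : ℤ, j' ≤ N → (j' : ℂ) • a j' = -∑ k ∈ Finset.range N,
      ((k : ℂ) + 1) • (derivP k.succPNat * a (j' - (k + 1))) := fun j' h => by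
    rw [ha, smul_expCoeff _ coeff_zero_annihilationSeries commute_coeff_annihilationSeries h,
      ← Finset.sum_neg_distrib]
    refine Finset.sum_congr rfl fun k _ => ?_
    rw [coeff_succ_annihilationSeries, SymOp.neg_mul, smul_neg]
  -- The factor 1/(k+1) in [∂/∂p_{k+1}, H_i] cancels the weight k+1, so the extra terms telescope in
  -- `k`. Their sum is H_{i-1} a_{j-1}, which raises the coefficient j-1 supplied by the recursion
  -- to j.
  have hterm : ∀ k ∈ Finset.range N,
      ((k : ℂ) + 1) • (derivP k.succPNat * a (j - (k + 1))) * creation i =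
      creation i * (((k : ℂ) + 1) • (derivP k.succPNat * a (j - (k + 1)))) -
      creation (i - 1) * (((k : ℂ) + 1) • (derivP k.succPNat * a (j - 1 - (k + 1)))) +
      (creation (i - ((k : ℕ) + 1)) * a (j - ((k : ℕ) + 1)) -
        creation (i - ((k + 1 : ℕ) + 1)) * a (j - ((k + 1 : ℕ) + 1))) := by
    intro k hk
    rw [Finset.mem_range] at hk
    have hk' : (k : ℂ) + 1 ≠ 0 := by exact_mod_cast k.succ_ne_zero
    have e1 : j - (k + 1) - 1 = j - 1 - (k + 1 : ℤ) := by ring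
    have e2 : i - 1 - (k + 1) = i - ((k + 1 : ℕ) + 1 : ℤ) := by push_cast; ring
    have e3 : j - 1 - (k + 1) = j - ((k + 1 : ℕ) + 1 : ℤ) := by push_cast; ring
    rw [smul_mul_assoc, mul_assoc, ih (N - 1) (by omega) (j - (k + 1)) i (by omega), mul_sub,
      ← mul_assoc, ← mul_assoc, derivP_mul_creation, derivP_mul_creation, add_mul, add_mul,
      smul_sub, smul_add, smul_add, smul_mul_assoc, smul_mul_assoc, smul_inv_smul₀ hk',
      smul_inv_smul₀ hk', mul_smul_comm, mul_smul_comm, mul_assoc, mul_assoc, e1, e2, e3]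
    abel
  rw [← smul_mul_assoc, hrec j hN, SymOp.neg_mul, Finset.sum_mul, Finset.sum_congr rfl hterm,
    Finset.sum_add_distrib, Finset.sum_sub_distrib, ← Finset.mul_sum, ← Finset.mul_sum,
    Finset.sum_range_sub']
  have h1 := hrec j hN
  have h2 := hrec (j - 1) (by omega)
  rw [← neg_eq_iff_eq_neg] at h1 h2
  rw [← h1, ← h2]
  have h3 : a (j - ((N : ℕ) + 1)) = 0 := expCoeff_of_neg _ (by omega)
  rw [h3]
  simp only [Nat.cast_zero, zero_add, mul_zero, sub_zero, SymOp.mul_neg, mul_smul_comm, smul_sub]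
  push_cast
  refine LinearMap.ext fun f => ?_
  simp only [LinearMap.neg_apply, LinearMap.sub_apply, LinearMap.add_apply, LinearMap.smul_apply]
  module

theorem annihilation_zero : annihilation 0 = 1 := by
  have h := expCoeff_natCast annihilationSeries 0
  rw [Nat.cast_zero, expCoeff_zero] at h
  exact h.symm

theorem annihilation_succ_mul_creation (j : ℕ) (i : ℤ) :
    annihilation (j + 1) * creation i =
      creation i * annihilation (j + 1) - creation (i - 1) * annihilation j := by
  have h := expCoeff_annihilationSeries_mul_creation (j + 1 : ℕ) i
  rw [show ((j + 1 : ℕ) : ℤ) - 1 = (j : ℕ) by push_cast; ring, expCoeff_natCast,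
    expCoeff_natCast] at h
  exact h

/-! ### Products of two Bernstein operators -/

theorem exists_annihilation_eq_zero (f : SymFun) : ∃ N, ∀ j, N ≤ j → annihilation j f = 0 := by
  obtain ⟨N, hN⟩ := (annihilation_finite f).bddAbove
  refine ⟨N + 1, fun j hj => ?_⟩
  by_contra h
  have := hN h
  omega

theorem B_apply (n : ℤ) (f : SymFun) {N : ℕ} (hN : ∀ j, N ≤ j → annihilation j f = 0) :
    B n f = ∑ j ∈ Finset.range N, creation (n + j) (annihilation j f) := by
  refine finsum_eq_sum_of_support_subset _ fun j hj => ?_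
  rw [Finset.coe_range, Set.mem_Iio]
  by_contra h
  exact hj (by simp only [hN j (not_lt.mp h), map_zero])

/-- The normally ordered form of a product of two Bernstein operators. -/
theorem B_mul_B_apply (a b : ℤ) (f : SymFun) {M : ℕ}
    (hf : ∀ j, M ≤ j → annihilation j f = 0)
    (hb : ∀ j, M + 1 ≤ j → annihilation j (B b f) = 0) :
    (B a * B b) f =
      ∑ j ∈ Finset.range M, ∑ k ∈ Finset.range M,
        (creation (a + j) * creation (b + k) * (annihilation j * annihilation k)) f -
      ∑ j ∈ Finset.range M, ∑ k ∈ Finset.range M,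
        (creation (a + 1 + j) * creation (b - 1 + k) * (annihilation j * annihilation k)) f := by
  have hzero : ∀ k, annihilation M (annihilation k f) = 0 := fun k => by
    rw [← Module.End.mul_apply, (commute_annihilation M k).eq, Module.End.mul_apply, hf M le_rfl,
      map_zero]
  rw [Module.End.mul_apply, B_apply a _ hb, B_apply b f hf]
  simp only [map_sum]
  -- The term j = 0 is split off because `annihilation 0` is the identity and produces no
  -- correction.
  rw [Finset.sum_range_succ']
  have hsucc : ∀ j k : ℕ,
      creation (a + (j + 1 : ℕ)) (annihilation (j + 1) (creation (b + k) (annihilation k f))) =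
      (creation (a + (j + 1 : ℕ)) * creation (b + k) *
        (annihilation (j + 1) * annihilation k)) f -
      (creation (a + 1 + j) * creation (b - 1 + k) * (annihilation j * annihilation k)) f := by
    intro j k
    have h := LinearMap.congr_fun (annihilation_succ_mul_creation j (b + k)) (annihilation k f)
    simp only [Module.End.mul_apply, LinearMap.sub_apply] at h ⊢
    rw [h, map_sub, show a + ((j + 1 : ℕ) : ℤ) = a + 1 + j by push_cast; ring,
      show b + (k : ℤ) - 1 = b - 1 + k by ring]
  simp only [hsucc, Finset.sum_sub_distrib]
  have h0 : ∑ k ∈ Finset.range M,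
      creation (a + (0 : ℕ)) (annihilation 0 (creation (b + k) (annihilation k f))) =
      ∑ k ∈ Finset.range M, (creation (a + (0 : ℕ)) * creation (b + k) *
        (annihilation 0 * annihilation k)) f := by
    simp only [annihilation_zero, Module.End.mul_apply, Module.End.one_apply]
  rw [h0, sub_add_eq_add_sub]
  congr 1
  -- The split-off row rejoins the shifted ones; the surplus row j = M vanishes by `hzero`.
  rw [← Finset.sum_range_succ' (fun j => ∑ k ∈ Finset.range M,
    (creation (a + j) * creation (b + k) * (annihilation j * annihilation k)) f),
    Finset.sum_range_succ, add_eq_left]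
  refine Finset.sum_eq_zero fun k _ => ?_
  simp only [Module.End.mul_apply, hzero, map_zero]

/-- The normally ordered forms are S(a, b) - S(a+1, b-1) and S(b-1, a+1) - S(b, a), opposite by the
symmetry of S. -/
theorem B_mul_B (a b : ℤ) : B a * B b = -(B (b - 1) * B (a + 1)) := by
  refine LinearMap.ext fun f => ?_
  obtain ⟨N₁, h₁⟩ := exists_annihilation_eq_zero f
  obtain ⟨N₂, h₂⟩ := exists_annihilation_eq_zero (B b f)
  obtain ⟨N₃, h₃⟩ := exists_annihilation_eq_zero (B (a + 1) f)
  have hf : ∀ j, N₁ + N₂ + N₃ ≤ j → annihilation j f = 0 := fun j hj => h₁ j (by omega)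
  rw [LinearMap.neg_apply, B_mul_B_apply a b f hf fun j hj => h₂ j (by omega),
    B_mul_B_apply (b - 1) (a + 1) f hf fun j hj => h₃ j (by omega), neg_sub, sub_add_cancel,
    add_sub_cancel_right]
  congr 1
  · rw [Finset.sum_comm]
    refine Finset.sum_congr rfl fun j _ => Finset.sum_congr rfl fun k _ => ?_
    rw [(commute_creation _ _).eq, (commute_annihilation _ _).eq]
  · rw [Finset.sum_comm]
    refine Finset.sum_congr rfl fun j _ => Finset.sum_congr rfl fun k _ => ?_
    rw [(commute_creation _ _).eq, (commute_annihilation _ _).eq]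

theorem B_mul_B_succ (a : ℤ) : B a * B (a + 1) = 0 := by
  have h := B_mul_B a (a + 1)
  rw [add_sub_cancel_right] at h
  refine LinearMap.ext fun f => ?_
  have hf := LinearMap.congr_fun h f
  rw [LinearMap.neg_apply] at hf
  exact self_eq_neg.mp hf

end Operators

/-! ### Straightening a composition -/

theorem BSeq_append_cons_cons (l₁ l₂ : List ℕ) (a b : ℕ) :
    BSeq (l₁ ++ a :: b :: l₂) = BSeq l₁ * (B a * B b) * BSeq l₂ := by
  simp [BSeq, mul_assoc]

end Bernstein

/-- A list that is not weakly decreasing has an ascent at two consecutive places. -/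
theorem List.exists_ascent_of_not_pairwise (l : List ℕ) (h : ¬ l.Pairwise (fun a b => b ≤ a)) :
    ∃ l₁ l₂ a b, l = l₁ ++ a :: b :: l₂ ∧ a < b := by
  induction l with
  | nil => exact absurd List.Pairwise.nil h
  | cons x l ih =>
    by_cases hl : l.Pairwise (fun a b => b ≤ a)
    · rcases l with _ | ⟨y, l⟩
      · exact absurd (List.pairwise_singleton _ _) h
      · refine ⟨[], l, x, y, rfl, ?_⟩
        by_contra hxy
        refine h (List.pairwise_cons.mpr ⟨fun z hz => ?_, hl⟩)
        rcases List.mem_cons.mp hz with rfl | hz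
        · exact not_lt.mp hxy
        · exact ((List.pairwise_cons.mp hl).1 z hz).trans (not_lt.mp hxy)
    · obtain ⟨l₁, l₂, a, b, rfl, hab⟩ := ih hl
      exact ⟨x :: l₁, l₂, a, b, rfl, hab⟩

theorem corollary4p4 (m : ℕ) (μ : List ℕ) (hμ : Bernstein.IsCompositionOf μ m) :
    Bernstein.BSeq μ = 0 ∨
      ∃ ν : List ℕ, Bernstein.IsPartitionOf ν m ∧ ν.length = μ.length ∧
        ((∀ a ∈ μ, 0 < a) → ∀ a ∈ ν, 0 < a) ∧
        (Bernstein.BSeq μ = Bernstein.BSeq ν ∨ Bernstein.BSeq μ = -Bernstein.BSeq ν) := by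
  -- The sum of squares decreases at each straightening step.
  induction hs : (μ.map fun i => i ^ 2).sum using Nat.strong_induction_on generalizing μ with
  | _ s ih =>
  by_cases hdec : μ.Pairwise (fun a b => b ≤ a)
  · exact Or.inr ⟨μ, ⟨hdec, hμ⟩, rfl, id, Or.inl rfl⟩
  obtain ⟨l₁, l₂, a, b, rfl, hab⟩ := List.exists_ascent_of_not_pairwise μ hdec
  obtain ⟨d, rfl⟩ : ∃ d, b = a + 1 + d := ⟨b - (a + 1), by omega⟩
  -- The case b = a + 1 is the one where the product vanishes.
  rcases d with _ | d
  · left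
    have := Bernstein.B_mul_B_succ a
    rw [Bernstein.BSeq_append_cons_cons, add_zero, Nat.cast_succ, this, mul_zero, zero_mul]
  have hB : Bernstein.BSeq (l₁ ++ a :: (a + 1 + (d + 1)) :: l₂) =
      -Bernstein.BSeq (l₁ ++ (a + 1 + d) :: (a + 1) :: l₂) := by
    rw [Bernstein.BSeq_append_cons_cons, Bernstein.BSeq_append_cons_cons, Bernstein.B_mul_B,
      show ((a + 1 + (d + 1) : ℕ) : ℤ) - 1 = (a + 1 + d : ℕ) by push_cast; ring, ← Nat.cast_succ]
    rw [Bernstein.SymOp.mul_neg, Bernstein.SymOp.neg_mul]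
  have hsum : Bernstein.IsCompositionOf (l₁ ++ (a + 1 + d) :: (a + 1) :: l₂) m := by
    simp only [Bernstein.IsCompositionOf, List.sum_append, List.sum_cons] at hμ ⊢
    omega
  have hlt : ((l₁ ++ (a + 1 + d) :: (a + 1) :: l₂).map fun i => i ^ 2).sum < s := by
    rw [← hs]
    simp only [List.map_append, List.map_cons, List.sum_append, List.sum_cons]
    -- Replacing (a, b) by (b-1, a+1) lowers the sum of squares by 2(b-a-1) = 2(d+1).
    nlinarith
  rcases ih _ hlt _ hsum rfl with h0 | ⟨ν, hν, hlen, hpos, hsign⟩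
  · left
    rw [hB, h0, neg_zero]
  · refine Or.inr ⟨ν, hν, by rw [hlen]; simp, fun h => hpos fun x hx => ?_, ?_⟩
    · simp only [List.mem_append, List.mem_cons] at h hx
      -- The two new parts a+1+d and a+1 are positive in any case.
      rcases hx with hx | rfl | rfl | hx
      · exact h x (Or.inl hx)
      · omega
      · omega
      · exact h x (Or.inr (Or.inr (Or.inr hx)))
    · rw [hB]
      rcases hsign with h | h
      · exact Or.inr (by rw [h])
      · exact Or.inl (by rw [h, neg_neg])
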